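/- Let $n\ge 2$ and let $M$ be a finite-dimensional smooth (Hausdorff) manifold without boundary. Let $\{\cdot,\dots,\cdot\}$ be a Nambu-Poisson structure of order $n-1$ on $M$, i.e. a skew-symmetric $\mathbb R$-$n$-linear bracket on $C^\infty(M)$ such that $\{f_1g,f_2,\dots,f_n\}=f_1\{g,f_2,\dots,f_n\}+g\{f_1,\dots,f_n\}$ and $$\{f_1,\dots,f_{n-1},\{g_1,\dots,g_n\}\}=\sum_{i=1}^n\{g_1,\dots,\{f_1,\dots,f_{n-1},g_i\},\dots,g_n\},$$ and let $\pi\in\mathfrak X^n(M)$ be the $n$-vector field with $\{f_1,\dots,f_n\}=\pi(df_1,\dots,df_n)$. Let $\pi^\sharp:\wedge^{n-1}T^*M\to TM$ be the bundle map with $\langle\pi^\sharp(\xi_1\wedge\dots\wedge\xi_{n-1}),\xi_n\rangle=\pi(\xi_1,\dots,\xi_n)$. For $X,Y\in\mathfrak X(M)$ and $\alpha,\beta\in\Omega^{n-1}(M)$ put $$(X+\alpha,Y+\beta)_+=i_X\beta+i_Y\alpha\in\Omega^{n-2}(M),\qquad \rho_\pi(X+\alpha)=X+\pi^\sharp(\alpha),$$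 $$[\alpha,\beta]_\pi=L_{\pi^\sharp(\alpha)}\beta-L_{\pi^\sharp(\beta)}\alpha+d\,i_{\pi^\sharp(\beta)}\alpha,$$ $$[\![X+\alpha,Y+\beta]\!]_\pi=[X,Y]+[X,\pi^\sharp(\beta)]+[\pi^\sharp(\alpha),Y]-\pi^\sharp(L_X\beta)+\pi^\sharp(i_Yd\alpha)+L_X\beta-i_Yd\alpha+[\alpha,\beta]_\pi .$$ Let $\mathfrak X_H(M)$ be the space of Hamiltonian vector fields, that is, the real linear span of the vector fields $\pi^\sharp(df_1\wedge\dots\wedge df_{n-1})$ with $f_1,\dots,f_{n-1}\in C^\infty(M)$, and let $\Omega^{n-1}_{\mathrm{cl}}(M)$ be the space of closed smooth $(n-1)$-forms. Then for all $e_1,e_2,e_3\in\mathfrak X_H(M)\oplus\Omega^{n-1}_{\mathrm{cl}}(M)$, $$L_{\rho_\pi(e_1)}(e_2,e_3)_+=([\![e_1,e_2]\!]_\pi,e_3)_++(e_2,[\![e_1,e_3]\!]_\pi)_+ .$$ -/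

import Mathlib

open scoped Manifold ContDiff

namespace NambuCourant

noncomputable section

variable (E : Type*) [NormedAddCommGroup E] [NormedSpace ℝ E]
variable (M : Type*) [TopologicalSpace M] [ChartedSpace E M]

/-! ### Fields on a manifold modelled on `E`

Vector fields, differential forms and multivector fields are families indexed by the points of
`M`; smoothness is a separate predicate, and every operation below is defined pointwise.
The tangent space `T_x M = TangentSpace 𝓘(ℝ, E) x` is by definition a copy of the model space `E`
(whose identification with `E` is given by the preferred chart at `x`), so that forms and
multivectors at `x` are written as alternating maps on `E` and on its dual. -/

/-- Vector fields on `M`. -/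
abbrev VField := (x : M) → TangentSpace 𝓘(ℝ, E) x

/-- Differential forms of degree `k` on `M`: alternating `k`-linear forms on each `T_x M`. -/
abbrev Form (k : ℕ) := M → E [⋀^Fin k]→L[ℝ] ℝ

/-- `n`-vector fields on `M`: an element of `⋀ⁿ T_x M` is an alternating `n`-linear form on the
cotangent space `T_x^* M`. -/
abbrev MultiVField (n : ℕ) := M → (E →L[ℝ] ℝ) [⋀^Fin n]→L[ℝ] ℝ

/-- Sections `X + α` of `TM ⊕ ⋀^k T^*M`, as pairs `(X, α)`. -/
abbrev Sec (k : ℕ) := VField E M × Form E M k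

variable {E M}

/-! ### Expressions in charts and smoothness -/

/-- The differential `T_x M → E` at `x` of the preferred chart at `x₀`. -/
def chartD (x₀ x : M) : E →L[ℝ] E :=
  mfderiv 𝓘(ℝ, E) 𝓘(ℝ, E) (extChartAt 𝓘(ℝ, E) x₀) x

/-- The differential `E → T_x M`, `x = φ⁻¹(z)`, at `z` of the inverse of the preferred chart `φ`
at `x₀`. -/
def chartSymmD (x₀ : M) (z : E) : E →L[ℝ] E :=
  mfderiv 𝓘(ℝ, E) 𝓘(ℝ, E) (extChartAt 𝓘(ℝ, E) x₀).symm z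

/-- A vector field, written in the preferred chart at `x₀`. -/
def vectorInChart (x₀ : M) (X : VField E M) : E → E :=
  VectorField.mpullback 𝓘(ℝ, E) 𝓘(ℝ, E) (extChartAt 𝓘(ℝ, E) x₀).symm X

/-- A differential form, written in the preferred chart at `x₀` (that is, pulled back along the
inverse of the chart). -/
def formInChart (x₀ : M) {k : ℕ} (θ : Form E M k) : E → E [⋀^Fin k]→L[ℝ] ℝ := fun z =>
  (θ ((extChartAt 𝓘(ℝ, E) x₀).symm z)).compContinuousLinearMap (chartSymmD x₀ z)

/-- A multivector field, written in the preferred chart at `x₀`: a covector `ξ` at a point of the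
chart is evaluated after pulling it back to `M` along the chart. -/
def multivectorInChart (x₀ : M) {n : ℕ} (P : MultiVField E M n) :
    E → (E →L[ℝ] ℝ) [⋀^Fin n]→L[ℝ] ℝ := fun z =>
  (P ((extChartAt 𝓘(ℝ, E) x₀).symm z)).compContinuousLinearMap
    (ContinuousLinearMap.precomp ℝ (chartD x₀ ((extChartAt 𝓘(ℝ, E) x₀).symm z)))

/-- A form is smooth if it is smooth in every preferred chart. -/
def IsSmoothForm {k : ℕ} (θ : Form E M k) : Prop :=
  ∀ x₀ : M, ContDiffOn ℝ ∞ (formInChart x₀ θ) (extChartAt 𝓘(ℝ, E) x₀).target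

/-- A multivector field is smooth if it is smooth in every preferred chart. -/
def IsSmoothMultiVField {n : ℕ} (P : MultiVField E M n) : Prop :=
  ∀ x₀ : M, ContDiffOn ℝ ∞ (multivectorInChart x₀ P) (extChartAt 𝓘(ℝ, E) x₀).target

/-! ### Cartan calculus -/

/-- The interior product `i_X θ = θ(X, ·, …, ·)`. -/
def interiorProd {k : ℕ} (X : VField E M) (θ : Form E M (k + 1)) : Form E M k := fun x =>
  (θ x).curryLeft (X x)

/-- The exterior derivative, computed at `x` in the chart at `x`. -/
def extD {k : ℕ} (θ : Form E M k) : Form E M (k + 1) := fun x =>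
  (extDeriv (formInChart x θ) (extChartAt 𝓘(ℝ, E) x x)).compContinuousLinearMap (chartD x x)

/-- The Lie derivative of a vector-space form `θ` along a vector field `X`:
`(L_X θ)(v₁, …, v_k) = (D_X θ)(v₁, …, v_k) + ∑ᵢ θ(v₁, …, D_{vᵢ} X, …, v_k)`. -/
def lieDerivModel {k : ℕ} (X : E → E) (θ : E → E [⋀^Fin k]→L[ℝ] ℝ) (z : E) :
    E [⋀^Fin k]→L[ℝ] ℝ :=
  fderiv ℝ θ z (X z) +
    (θ z).fderivCompContinuousLinearMap (ContinuousLinearMap.id ℝ E) (fderiv ℝ X z)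

/-- The Lie derivative `L_X θ`, computed at `x` in the chart at `x`. -/
def lieD {k : ℕ} (X : VField E M) (θ : Form E M k) : Form E M k := fun x =>
  (lieDerivModel (vectorInChart x X) (formInChart x θ)
      (extChartAt 𝓘(ℝ, E) x x)).compContinuousLinearMap (chartD x x)

/-- The Lie bracket of vector fields. -/
abbrev lieBr (X Y : VField E M) : VField E M := VectorField.mlieBracket 𝓘(ℝ, E) X Y

/-- The differential of a smooth function at a point, as a covector. -/
def dFun (f : C^∞⟮𝓘(ℝ, E), M; ℝ⟯) (x : M) : E →L[ℝ] ℝ :=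
  mfderiv 𝓘(ℝ, E) 𝓘(ℝ, ℝ) f x

/-- The exterior product of covectors:
`(ξ₁ ∧ … ∧ ξ_k)(v₁, …, v_k) = ∑_σ sign(σ) ∏ᵢ ξᵢ(v_{σ(i)}) = det (ξᵢ(vⱼ))`. -/
def wedge {k : ℕ} (ξ : Fin k → E →L[ℝ] ℝ) : E [⋀^Fin k]→L[ℝ] ℝ :=
  ContinuousMultilinearMap.alternatization
    ((ContinuousMultilinearMap.mkPiAlgebra ℝ (Fin k) ℝ).compContinuousLinearMap ξ)

/-- The `k`-form `df₁ ∧ … ∧ df_k`. -/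
def dWedge {k : ℕ} (f : Fin k → C^∞⟮𝓘(ℝ, E), M; ℝ⟯) : Form E M k := fun x =>
  wedge (fun i => dFun (f i) x)

/-! ### The map `π^♯` -/

variable [FiniteDimensional ℝ E]

/-- The covector dual to the `j`-th vector of a basis of `E`. -/
def dualVec (j : Fin (Module.finrank ℝ E)) : E →L[ℝ] ℝ :=
  LinearMap.toContinuousLinearMap ((Module.finBasis ℝ E).coord j)

/-- The contraction of an alternating `(k+1)`-form `α` with a `(k+2)`-vector `P` in the first
`k+1` slots, in a basis `(b_j)` with dual basis `(b^j)`: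
`P^♯(α) = 1/(k+1)! ∑_{i₀,…,i_k,j} α(b_{i₀}, …, b_{i_k}) P(b^{i₀}, …, b^{i_k}, b^j) b_j`.
This is the linear map with
`⟨P^♯(ξ₀ ∧ … ∧ ξ_k), η⟩ = P(ξ₀, …, ξ_k, η)`, see `sharpAt_wedge`. -/
def sharpAt {k : ℕ} (P : (E →L[ℝ] ℝ) [⋀^Fin (k + 2)]→L[ℝ] ℝ) (α : E [⋀^Fin (k + 1)]→L[ℝ] ℝ) :
    E :=
  ((k + 1).factorial : ℝ)⁻¹ •
    ∑ i : Fin (k + 1) → Fin (Module.finrank ℝ E), ∑ j : Fin (Module.finrank ℝ E),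
      (α (fun l => Module.finBasis ℝ E (i l)) *
        P (Fin.snoc (α := fun _ => E →L[ℝ] ℝ) (fun l => dualVec (i l)) (dualVec j))) •
        Module.finBasis ℝ E j

/-- The defining property of `P^♯` on decomposable forms. -/
theorem sharpAt_wedge {k : ℕ} (P : (E →L[ℝ] ℝ) [⋀^Fin (k + 2)]→L[ℝ] ℝ)
    (ξ : Fin (k + 1) → E →L[ℝ] ℝ) (η : E →L[ℝ] ℝ) :
    η (sharpAt P (wedge ξ)) = P (Fin.snoc (α := fun _ => E →L[ℝ] ℝ) ξ η) := by
  have expand : ∀ ζ : E →L[ℝ] ℝ, ζ = ∑ j, ζ (Module.finBasis ℝ E j) • dualVec j := by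
    intro ζ
    apply ContinuousLinearMap.coe_injective
    apply (Module.finBasis ℝ E).ext
    intro i
    simp [dualVec, Finsupp.single_apply]
  let R : (E →L[ℝ] ℝ) [⋀^Fin (k + 1)]→ₗ[ℝ] ℝ :=
    { toFun := fun v => P (Fin.snoc (α := fun _ => E →L[ℝ] ℝ) v η)
      map_update_add' := by
        intro _ v i x y
        have := MultilinearMap.map_update_add (P.toMultilinearMap.curryRight) v i x y
        exact congrArg (fun L : (E →L[ℝ] ℝ) →ₗ[ℝ] ℝ => L η) this
      map_update_smul' := by
        intro _ v i c x
        have := MultilinearMap.map_update_smul (P.toMultilinearMap.curryRight) v i c x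
        exact congrArg (fun L : (E →L[ℝ] ℝ) →ₗ[ℝ] ℝ => L η) this
      map_eq_zero_of_eq' := by
        intro v i j h hij
        exact P.map_eq_zero_of_eq _ (i := i.castSucc) (j := j.castSucc) (by simpa using h)
          (by simpa using hij) }
  have inner : ∀ v : Fin (k + 1) → E →L[ℝ] ℝ,
      ∑ j, P (Fin.snoc (α := fun _ => E →L[ℝ] ℝ) v (dualVec j)) * η (Module.finBasis ℝ E j)
        = R v := by
    intro v
    have h := congrArg (fun ζ => P.toMultilinearMap.curryRight v ζ) (expand η)
    simp only [map_sum, map_smul, smul_eq_mul] at h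
    exact ((Finset.sum_congr rfl fun j _ => mul_comm _ _).trans h.symm)
  have outer : ∀ σ : Equiv.Perm (Fin (k + 1)),
      ∑ i : Fin (k + 1) → Fin (Module.finrank ℝ E),
        (Equiv.Perm.sign σ • ∏ l, ξ l (Module.finBasis ℝ E (i (σ l)))) *
          R (fun l => dualVec (i l)) = R ξ := by
    intro σ
    rw [← Equiv.sum_comp (Equiv.arrowCongr σ (Equiv.refl _))]
    have h : R ξ = ∑ i : Fin (k + 1) → Fin (Module.finrank ℝ E),
        (∏ l, ξ l (Module.finBasis ℝ E (i l))) * R (fun l => dualVec (i l)) := by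
      conv_lhs => rw [funext fun l => expand (ξ l)]
      rw [← AlternatingMap.coe_multilinearMap, MultilinearMap.map_sum]
      refine Finset.sum_congr rfl fun i _ => ?_
      rw [MultilinearMap.map_smul_univ]
      rfl
    rw [h]
    refine Finset.sum_congr rfl fun i _ => ?_
    have hp := R.map_perm (fun l => dualVec (i l)) σ.symm
    have : (fun l => dualVec (((σ.arrowCongr (Equiv.refl _)) i) l))
        = (fun l => (dualVec (i l) : E →L[ℝ] ℝ)) ∘ σ.symm := by
      funext l; simp [Equiv.arrowCongr]
    rw [this, hp]
    rcases Int.units_eq_one_or (Equiv.Perm.sign σ) with hs | hs <;> simp [hs, Equiv.arrowCongr]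
  have hfac : ((k + 1).factorial : ℝ) ≠ 0 := by positivity
  change _ = R ξ
  simp only [sharpAt, map_smul, map_sum, smul_eq_mul]
  rw [inv_mul_eq_iff_eq_mul₀ hfac]
  have : ∀ i : Fin (k + 1) → Fin (Module.finrank ℝ E),
      ∑ j, (wedge ξ (fun l => Module.finBasis ℝ E (i l)) *
        P (Fin.snoc (α := fun _ => E →L[ℝ] ℝ) (fun l => dualVec (i l)) (dualVec j))) *
        η (Module.finBasis ℝ E j)
      = ∑ σ : Equiv.Perm (Fin (k + 1)),
        (Equiv.Perm.sign σ • ∏ l, ξ l (Module.finBasis ℝ E (i (σ l)))) *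
          R (fun l => dualVec (i l)) := by
    intro i
    simp only [mul_assoc]
    rw [← Finset.mul_sum, inner, ← Finset.sum_mul]
    simp [wedge, ContinuousMultilinearMap.alternatization_apply_apply]
  simp only [this]
  rw [Finset.sum_comm]
  simp [outer, Fintype.card_perm]

/-- The bundle map `π^♯ : ⋀^{n-1} T^*M → TM` (with `n = k + 2`), on sections. -/
def sharp {k : ℕ} (π : MultiVField E M (k + 2)) (α : Form E M (k + 1)) : VField E M := fun x =>
  sharpAt (E := E) (π x) (α x)

/-! ### Nambu-Poisson manifolds -/

variable (E M) in
/-- A Nambu-Poisson structure of order `n - 1` on `M`, with `n = k + 2 ≥ 2`: an `n`-linear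
skew-symmetric bracket on `C^∞(M)` which satisfies the Leibniz rule and the fundamental identity
(integrability condition). -/
structure NambuPoissonBracket (k : ℕ) where
  /-- The bracket `{f₁, …, f_n}`. -/
  bracket : C^∞⟮𝓘(ℝ, E), M; ℝ⟯ [⋀^Fin (k + 2)]→ₗ[ℝ] C^∞⟮𝓘(ℝ, E), M; ℝ⟯
  /-- `{f₁ g, f₂, …, f_n} = f₁ {g, f₂, …, f_n} + g {f₁, …, f_n}`. -/
  leibniz : ∀ (f : Fin (k + 2) → C^∞⟮𝓘(ℝ, E), M; ℝ⟯) (g : C^∞⟮𝓘(ℝ, E), M; ℝ⟯),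
    bracket (Function.update f 0 (f 0 * g)) =
      f 0 * bracket (Function.update f 0 g) + g * bracket f
  /-- `{f₁, …, f_{n-1}, {g₁, …, g_n}} = ∑ᵢ {g₁, …, {f₁, …, f_{n-1}, gᵢ}, …, g_n}`. -/
  fundamental : ∀ (f : Fin (k + 1) → C^∞⟮𝓘(ℝ, E), M; ℝ⟯)
    (g : Fin (k + 2) → C^∞⟮𝓘(ℝ, E), M; ℝ⟯),
    bracket (Fin.snoc (α := fun _ => C^∞⟮𝓘(ℝ, E), M; ℝ⟯) f (bracket g)) =
      ∑ i, bracket (Function.update g i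
        (bracket (Fin.snoc (α := fun _ => C^∞⟮𝓘(ℝ, E), M; ℝ⟯) f (g i))))

/-- `(M, π)` is a Nambu-Poisson manifold: `π` is the smooth `n`-vector field of a Nambu-Poisson
structure, that is, `{f₁, …, f_n} = π(df₁, …, df_n)`. -/
def IsNambuPoisson {k : ℕ} (π : MultiVField E M (k + 2)) : Prop :=
  IsSmoothMultiVField π ∧ ∃ N : NambuPoissonBracket E M k,
    ∀ (f : Fin (k + 2) → C^∞⟮𝓘(ℝ, E), M; ℝ⟯) (x : M),
      N.bracket f x = π x (fun i => dFun (f i) x)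

/-- The space `𝔛_H(M)` of Hamiltonian vector fields: the real linear span of the fields
`π^♯(df₁ ∧ … ∧ df_{n-1})`. -/
def hamiltonianFields {k : ℕ} (π : MultiVField E M (k + 2)) : Submodule ℝ (VField E M) :=
  Submodule.span ℝ (Set.range fun f : Fin (k + 1) → C^∞⟮𝓘(ℝ, E), M; ℝ⟯ => sharp π (dWedge f))

/-- The smooth closed `k`-forms. -/
def closedForms (E M : Type*) [NormedAddCommGroup E] [NormedSpace ℝ E] [TopologicalSpace M]
    [ChartedSpace E M] (k : ℕ) : Set (Form E M k) :=
  {α | IsSmoothForm α ∧ extD α = 0}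

/-! ### The higher analogue of the Courant algebroid of a Nambu-Poisson manifold -/

/-- The pairing `(X + α, Y + β)₊ = i_X β + i_Y α`. -/
def pairing {k : ℕ} (e₁ e₂ : Sec E M (k + 1)) : Form E M k :=
  interiorProd e₁.1 e₂.2 + interiorProd e₂.1 e₁.2

/-- The anchor `ρ_π(X + α) = X + π^♯(α)`. -/
def anchor {k : ℕ} (π : MultiVField E M (k + 2)) (e : Sec E M (k + 1)) : VField E M :=
  e.1 + sharp π e.2

/-- The bracket `[α, β]_π = L_{π^♯ α} β - L_{π^♯ β} α + d i_{π^♯ β} α` of forms. -/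
def formBracket {k : ℕ} (π : MultiVField E M (k + 2)) (α β : Form E M (k + 1)) :
    Form E M (k + 1) :=
  lieD (sharp π α) β - lieD (sharp π β) α + extD (interiorProd (sharp π β) α)

/-- The bracket
`⟦X + α, Y + β⟧_π = [X, Y] + [X, π^♯ β] + [π^♯ α, Y] - π^♯(L_X β) + π^♯(i_Y dα)
  + L_X β - i_Y dα + [α, β]_π`. -/
def courantBracket {k : ℕ} (π : MultiVField E M (k + 2)) (e₁ e₂ : Sec E M (k + 1)) :
    Sec E M (k + 1) :=
  (lieBr e₁.1 e₂.1 + lieBr e₁.1 (sharp π e₂.2) + lieBr (sharp π e₁.2) e₂.1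
      - sharp π (lieD e₁.1 e₂.2) + sharp π (interiorProd e₂.1 (extD e₁.2)),
    lieD e₁.1 e₂.2 - interiorProd e₂.1 (extD e₁.2) + formBracket π e₁.2 e₂.2)

end

end NambuCourant

open NambuCourant

open scoped Topology

/-! Write `e₁ = X + α`, `e₂ = Y + β` and `Z = ρ_π(e₁)`. On Hamiltonian fields and closed forms the
bracket collapses to `⟦e₁, e₂⟧_π = [Z, Y] + L_Z β` (`courantBracket_of_closed`), and the claim
becomes the Leibniz rule `L_Z i_Y θ = i_{[Z,Y]} θ + i_Y L_Z θ` (`lieD_interiorProd`), applied to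
both terms of the pairing.

The collapse has two causes. Since `dα = 0`, the terms with `i_Y dα` vanish and Cartan's formula
(`lieD_eq_cartan`) gives `L_{π^♯ β} α = d i_{π^♯ β} α`, so `[α, β]_π = L_{π^♯ α} β`. Since `X` is
Hamiltonian, `L_X π = 0`, hence `[X, π^♯ β] = π^♯(L_X β)` (`hamiltonianFields_lieBr_sharp`).

The vanishing of `L_X π` is the fundamental identity, tested on functions `gᵢ` that are linear in a
chart (`fderiv_multivectorInChart_hamiltonian`). All identities are proved on the model space and
transferred pointwise, each at the centre `x` of the chart at `x`. -/

namespace NambuCourant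

noncomputable section

/-! ### Cartan calculus on the model vector space. -/

section Model

variable {E : Type*} [NormedAddCommGroup E] [NormedSpace ℝ E] {k : ℕ}

theorem fderivComp_id_apply (θ : E [⋀^Fin k]→L[ℝ] ℝ) (A : E →L[ℝ] E) (v : Fin k → E) :
    θ.fderivCompContinuousLinearMap (ContinuousLinearMap.id ℝ E) A v =
      ∑ i, θ (Function.update v i (A (v i))) := by
  rw [ContinuousAlternatingMap.fderivCompContinuousLinearMap_apply]
  refine Finset.sum_congr rfl fun i _ => ?_
  congr 1
  funext j
  by_cases h : j = i
  · subst h; simp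
  · simp [Function.update_of_ne h]

/-- The product rule for the contraction of a form with a vector field. -/
theorem hasFDerivAt_contract {X : E → E} {θ : E → E [⋀^Fin (k + 1)]→L[ℝ] ℝ} {z : E}
    (hX : DifferentiableAt ℝ X z) (hθ : DifferentiableAt ℝ θ z) :
    HasFDerivAt (fun y => (θ y).curryLeft (X y))
      ((θ z).curryLeft ∘L fderiv ℝ X z +
        (ContinuousAlternatingMap.curryLeftLI.toContinuousLinearMap ∘L fderiv ℝ θ z).flip (X z))
      z := by
  have h := HasFDerivAt.comp (F := E [⋀^Fin (k + 1)]→L[ℝ] ℝ) (G := E →L[ℝ] E [⋀^Fin k]→L[ℝ] ℝ) z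
    (ContinuousAlternatingMap.curryLeftLI.toContinuousLinearMap.hasFDerivAt) hθ.hasFDerivAt
  exact h.clm_apply hX.hasFDerivAt

theorem fderiv_contract_apply {X : E → E} {θ : E → E [⋀^Fin (k + 1)]→L[ℝ] ℝ} {z : E}
    (hX : DifferentiableAt ℝ X z) (hθ : DifferentiableAt ℝ θ z) (w : E) (v : Fin k → E) :
    fderiv ℝ (fun y => (θ y).curryLeft (X y)) z w v =
      θ z (Matrix.vecCons (fderiv ℝ X z w) v) + fderiv ℝ θ z w (Matrix.vecCons (X z) v) := by
  rw [(hasFDerivAt_contract hX hθ).fderiv]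
  rfl

/-- Cartan's formula `L_X θ = i_X dθ + d i_X θ`. -/
theorem lieDerivModel_eq_cartan {X : E → E} {θ : E → E [⋀^Fin (k + 1)]→L[ℝ] ℝ} {z : E}
    (hX : DifferentiableAt ℝ X z) (hθ : DifferentiableAt ℝ θ z) :
    lieDerivModel X θ z = (extDeriv θ z).curryLeft (X z) +
      extDeriv (fun y => (θ y).curryLeft (X y)) z := by
  ext v
  rw [lieDerivModel, ContinuousAlternatingMap.add_apply, ContinuousAlternatingMap.add_apply,
    fderivComp_id_apply, ContinuousAlternatingMap.curryLeft_apply_apply, extDeriv, extDeriv,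
    ContinuousAlternatingMap.alternatizeUncurryFin_apply,
    ContinuousAlternatingMap.alternatizeUncurryFin_apply, Fin.sum_univ_succ (n := k + 1)]
  simp only [fderiv_contract_apply hX hθ, smul_add, Finset.sum_add_distrib]
  -- Moving the `i`-th argument to the front costs the sign `(-1)^i` carried by the exterior
  -- derivative of `i_X θ`. The terms differentiating `θ` along `v i` occur in `i_X dθ` and `d i_X
  -- θ` with opposite signs and cancel.
  have h₁ : ∀ i : Fin (k + 1), θ z (Function.update v i (fderiv ℝ X z (v i))) =
      (-1) ^ (i : ℕ) • θ z (Matrix.vecCons (fderiv ℝ X z (v i)) (i.removeNth v)) := by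
    intro i
    rw [← Fin.insertNth_removeNth]
    exact (θ z).toAlternatingMap.map_insertNth i _ _
  have h₂ : ∀ i : Fin (k + 1), i.succ.removeNth (Matrix.vecCons (X z) v) =
      Matrix.vecCons (X z) (i.removeNth v) := by
    intro i
    funext j
    refine Fin.cases ?_ (fun j => ?_) j <;> simp [Fin.removeNth_apply]
  simp [h₁, h₂, pow_succ, Fin.removeNth_zero]
  ring

/-- `L_X i_Y θ = i_{[X, Y]} θ + i_Y L_X θ`. -/
theorem lieDerivModel_contract {X Y : E → E} {θ : E → E [⋀^Fin (k + 1)]→L[ℝ] ℝ} {z : E}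
    (hY : DifferentiableAt ℝ Y z) (hθ : DifferentiableAt ℝ θ z) :
    lieDerivModel X (fun y => (θ y).curryLeft (Y y)) z =
      (θ z).curryLeft (VectorField.lieBracket ℝ X Y z) +
        (lieDerivModel X θ z).curryLeft (Y z) := by
  ext v
  simp only [lieDerivModel, ContinuousAlternatingMap.add_apply, fderivComp_id_apply,
    fderiv_contract_apply hY hθ, ContinuousAlternatingMap.curryLeft_apply_apply,
    Fin.sum_univ_succ, VectorField.lieBracket, map_sub, ContinuousAlternatingMap.sub_apply]
  have h : ∀ i : Fin k, Function.update (Matrix.vecCons (Y z) v) i.succ (fderiv ℝ X z (v i)) =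
      Matrix.vecCons (Y z) (Function.update v i (fderiv ℝ X z (v i))) := by
    intro i
    exact (Fin.cons_update ..).symm
  have h₀ : Function.update (Matrix.vecCons (Y z) v) 0 (fderiv ℝ X z (Y z)) =
      Matrix.vecCons (fderiv ℝ X z (Y z)) v := Fin.update_cons_zero ..
  -- The term `θ(DX(Y), v)` appears once from `L_X θ` and once, negatively, from `[X, Y] = DY(X) -
  -- DX(Y)`.
  simp only [Matrix.cons_val_zero, Matrix.cons_val_succ, h, h₀]
  ring

theorem lieDerivModel_add_left {X Y : E → E} {θ : E → E [⋀^Fin k]→L[ℝ] ℝ} {z : E}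
    (hX : DifferentiableAt ℝ X z) (hY : DifferentiableAt ℝ Y z) :
    lieDerivModel (X + Y) θ z = lieDerivModel X θ z + lieDerivModel Y θ z := by
  simp only [lieDerivModel, fderiv_add hX hY, Pi.add_apply, map_add]
  abel

theorem lieDerivModel_add_right {X : E → E} {θ η : E → E [⋀^Fin k]→L[ℝ] ℝ} {z : E}
    (hθ : DifferentiableAt ℝ θ z) (hη : DifferentiableAt ℝ η z) :
    lieDerivModel X (θ + η) z = lieDerivModel X θ z + lieDerivModel X η z := by
  ext v
  simp only [lieDerivModel, fderiv_add hθ hη, Pi.add_apply, ContinuousAlternatingMap.add_apply,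
    _root_.add_apply, fderivComp_id_apply, Finset.sum_add_distrib]
  ring

theorem lieDerivModel_smul_left {X : E → E} (c : ℝ) {θ : E → E [⋀^Fin k]→L[ℝ] ℝ} {z : E} :
    lieDerivModel (c • X) θ z = c • lieDerivModel X θ z := by
  simp only [lieDerivModel, fderiv_const_smul_field, Pi.smul_apply, map_smul, smul_add]

theorem lieDerivModel_congr {X : E → E} {θ η : E → E [⋀^Fin k]→L[ℝ] ℝ} {z : E}
    (h : θ =ᶠ[𝓝 z] η) : lieDerivModel X θ z = lieDerivModel X η z := by
  rw [lieDerivModel, lieDerivModel, h.fderiv_eq, h.self_of_nhds]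

end Model

/-! ### Decomposable forms and the linear algebra of `P^♯`. -/

section Algebra

variable {E : Type*} [NormedAddCommGroup E] [NormedSpace ℝ E] {k : ℕ}

theorem wedge_apply (ξ : Fin k → E →L[ℝ] ℝ) (v : Fin k → E) :
    wedge ξ v = ∑ σ : Equiv.Perm (Fin k), Equiv.Perm.sign σ • ∏ l, ξ l (v (σ l)) := by
  simp [wedge, ContinuousMultilinearMap.alternatization_apply_apply]

theorem wedge_comp (ξ : Fin k → E →L[ℝ] ℝ) (T : E →L[ℝ] E) :
    (wedge ξ).compContinuousLinearMap T = wedge (fun i => ξ i ∘L T) := by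
  ext v
  simp [wedge_apply]

theorem fderivComp_wedge (ξ : Fin k → E →L[ℝ] ℝ) (A : E →L[ℝ] E) :
    (wedge ξ).fderivCompContinuousLinearMap (ContinuousLinearMap.id ℝ E) A =
      ∑ i, wedge (Function.update ξ i (ξ i ∘L A)) := by
  ext v
  rw [fderivComp_id_apply, ContinuousAlternatingMap.sum_apply]
  simp only [wedge_apply]
  rw [Finset.sum_comm, Finset.sum_comm (γ := Fin k)]
  refine Finset.sum_congr rfl fun σ _ => ?_
  -- In the term of `σ`, the covector `ξ i` meets the vector `v (σ i)`. Reindexing by `σ` therefore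
  -- matches `A` applied to that vector with `ξ i` precomposed with `A`.
  rw [← Finset.smul_sum, ← Finset.smul_sum, ← Equiv.sum_comp σ]
  congr 1
  refine Finset.sum_congr rfl fun i _ => Finset.prod_congr rfl fun l _ => ?_
  by_cases h : l = i
  · subst h; simp
  · rw [Function.update_of_ne h, Function.update_of_ne (fun h' => h (σ.injective h'))]

variable [FiniteDimensional ℝ E]

/-- The decomposable forms span the alternating forms. -/
theorem eq_sum_wedge (α : E [⋀^Fin k]→L[ℝ] ℝ) :
    α = (k.factorial : ℝ)⁻¹ • ∑ i : Fin k → Fin (Module.finrank ℝ E),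
      α (fun l => Module.finBasis ℝ E (i l)) • wedge (fun l => dualVec (i l)) := by
  apply ContinuousAlternatingMap.toAlternatingMap_injective
  refine Module.Basis.ext_alternating (Module.finBasis ℝ E) fun m hm => ?_
  have hfac : (k.factorial : ℝ) ≠ 0 := by positivity
  change α (fun l => Module.finBasis ℝ E (m l)) = ((k.factorial : ℝ)⁻¹ •
    ∑ i : Fin k → Fin (Module.finrank ℝ E), α (fun l => Module.finBasis ℝ E (i l)) •
      wedge (fun l => dualVec (i l))) (fun l => Module.finBasis ℝ E (m l))
  rw [ContinuousAlternatingMap.smul_apply, ContinuousAlternatingMap.sum_apply, smul_eq_mul,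
    eq_inv_mul_iff_mul_eq₀ hfac]
  simp only [ContinuousAlternatingMap.smul_apply, wedge_apply, smul_eq_mul, Finset.mul_sum]
  rw [Finset.sum_comm]
  have key : ∀ σ : Equiv.Perm (Fin k),
      ∑ i : Fin k → Fin (Module.finrank ℝ E), α (fun l => Module.finBasis ℝ E (i l)) *
        (Equiv.Perm.sign σ • ∏ l, dualVec (i l) (Module.finBasis ℝ E (m (σ l)))) =
      α (fun l => Module.finBasis ℝ E (m l)) := by
    intro σ
    -- By duality of the bases only `i = m ∘ σ` survives, and the two signs of `σ` cancel. Each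
    -- permutation thus contributes the same value, and their number cancels `1/k!`.
    rw [Finset.sum_eq_single (m ∘ σ)]
    · have h := α.toAlternatingMap.map_perm (fun l => Module.finBasis ℝ E (m l)) σ
      change α (fun l => Module.finBasis ℝ E (m (σ l))) = _ • α _ at h
      simp only [Function.comp_apply, h]
      rcases Int.units_eq_one_or (Equiv.Perm.sign σ) with hs | hs <;> simp [hs, dualVec]
    · intro i _ hi
      obtain ⟨l, hl⟩ := Function.ne_iff.mp hi
      rw [Finset.prod_eq_zero (Finset.mem_univ l)]
      · simp
      · simpa [dualVec, Finsupp.single_apply, eq_comm] using hl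
    · simp
  simp [key, Fintype.card_perm]

theorem sharpAt_add_right (P : (E →L[ℝ] ℝ) [⋀^Fin (k + 2)]→L[ℝ] ℝ)
    (α β : E [⋀^Fin (k + 1)]→L[ℝ] ℝ) :
    sharpAt P (α + β) = sharpAt P α + sharpAt P β := by
  simp [sharpAt, add_mul, add_smul, Finset.sum_add_distrib, smul_add]

theorem sharpAt_smul_right (P : (E →L[ℝ] ℝ) [⋀^Fin (k + 2)]→L[ℝ] ℝ) (c : ℝ)
    (α : E [⋀^Fin (k + 1)]→L[ℝ] ℝ) :
    sharpAt P (c • α) = c • sharpAt P α := by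
  simp only [sharpAt, ContinuousAlternatingMap.smul_apply, smul_eq_mul, mul_assoc, mul_smul,
    ← Finset.smul_sum]
  rw [smul_comm]

/-- Two linear maps which agree on decomposable forms are equal. -/
theorem linearMap_ext_wedge {V : Type*} [AddCommGroup V] [Module ℝ V]
    {f g : (E [⋀^Fin k]→L[ℝ] ℝ) →ₗ[ℝ] V} (h : ∀ ξ, f (wedge ξ) = g (wedge ξ)) : f = g := by
  ext α
  rw [eq_sum_wedge α]
  simp only [map_smul, map_sum, h]

/-- The map `P^♯`, as a linear map. -/
def sharpLin (P : (E →L[ℝ] ℝ) [⋀^Fin (k + 2)]→L[ℝ] ℝ) : (E [⋀^Fin (k + 1)]→L[ℝ] ℝ) →ₗ[ℝ] E where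
  toFun := sharpAt P
  map_add' := sharpAt_add_right P
  map_smul' := sharpAt_smul_right P

/-- Naturality of `P^♯` under linear maps. -/
theorem sharpAt_comp (P : (E →L[ℝ] ℝ) [⋀^Fin (k + 2)]→L[ℝ] ℝ) (T : E →L[ℝ] E)
    (α : E [⋀^Fin (k + 1)]→L[ℝ] ℝ) :
    sharpAt (P.compContinuousLinearMap (ContinuousLinearMap.precomp ℝ T)) α =
      T (sharpAt P (α.compContinuousLinearMap T)) := by
  have h : sharpLin (P.compContinuousLinearMap (ContinuousLinearMap.precomp ℝ T)) =
      T.toLinearMap ∘ₗ sharpLin P ∘ₗ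
        (ContinuousAlternatingMap.compContinuousLinearMapCLM T).toLinearMap := by
    refine linearMap_ext_wedge fun ξ => ?_
    change sharpAt _ _ = T (sharpAt P ((wedge ξ).compContinuousLinearMap T))
    refine (SeparatingDual.eq_iff_forall_dual_eq (R := ℝ)).mpr fun η => ?_
    rw [wedge_comp, sharpAt_wedge]
    refine Eq.trans ?_ (sharpAt_wedge P (fun i => ξ i ∘L T) (η ∘L T)).symm
    change P _ = P _
    congr 1
    funext j
    refine Fin.lastCases ?_ (fun j => ?_) j <;> simp
  exact LinearMap.congr_fun h α

/-- If `Q` is the action of an endomorphism `A` on the multivector `P`, then `♯` intertwines the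
actions of `A`. -/
theorem sharpAt_derivation {P Q : (E →L[ℝ] ℝ) [⋀^Fin (k + 2)]→L[ℝ] ℝ} {A : E →L[ℝ] E}
    (hQ : ∀ ξ : Fin (k + 2) → E →L[ℝ] ℝ, Q ξ = ∑ i, P (Function.update ξ i (ξ i ∘L A)))
    (α : E [⋀^Fin (k + 1)]→L[ℝ] ℝ) :
    sharpAt Q α = A (sharpAt P α) +
      sharpAt P (α.fderivCompContinuousLinearMap (ContinuousLinearMap.id ℝ E) A) := by
  have h : sharpLin Q = A.toLinearMap ∘ₗ sharpLin P + sharpLin P ∘ₗ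
      { toFun := fun α => α.fderivCompContinuousLinearMap (ContinuousLinearMap.id ℝ E) A
        map_add' := fun α β => by
          ext v; simp only [fderivComp_id_apply, ContinuousAlternatingMap.add_apply,
            Finset.sum_add_distrib]
        map_smul' := fun c α => by
          ext v; simp only [fderivComp_id_apply, ContinuousAlternatingMap.smul_apply,
            Finset.smul_sum, RingHom.id_apply] } := by
    refine linearMap_ext_wedge fun ξ => ?_
    change sharpAt Q _ = A (sharpAt P (wedge ξ)) + sharpLin P
      ((wedge ξ).fderivCompContinuousLinearMap (ContinuousLinearMap.id ℝ E) A)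
    refine (SeparatingDual.eq_iff_forall_dual_eq (R := ℝ)).mpr fun η => ?_
    rw [fderivComp_wedge, map_sum, map_add, map_sum]
    change _ = _ + ∑ i, η (sharpAt P _)
    simp only [sharpAt_wedge]
    -- Among the `k + 2` slots, the last one holds `η` and yields `A (sharpAt P _)`. The others
    -- yield the action of `A` on the form.
    rw [hQ, Fin.sum_univ_castSucc, add_comm]
    congr 1
    · rw [Fin.snoc_last, Fin.update_snoc_last]
      exact (sharpAt_wedge P ξ (η ∘L A)).symm
    · refine Finset.sum_congr rfl fun i _ => ?_
      rw [Fin.snoc_castSucc, ← Fin.snoc_update]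
  exact LinearMap.congr_fun h α

end Algebra

/-! ### Derivatives of forms and of contractions with a multivector. -/

section Calculus

variable {E : Type*} [NormedAddCommGroup E] [NormedSpace ℝ E] {k : ℕ}

theorem hasFDerivAt_form_apply {F : Type*} [NormedAddCommGroup F] [NormedSpace ℝ F]
    {θ : E → F [⋀^Fin k]→L[ℝ] ℝ} {z : E} (hθ : DifferentiableAt ℝ θ z) (v : Fin k → F) :
    HasFDerivAt (fun y => θ y v)
      (ContinuousAlternatingMap.apply ℝ F ℝ v ∘L fderiv ℝ θ z) z :=
  HasFDerivAt.comp (F := F [⋀^Fin k]→L[ℝ] ℝ) (G := ℝ) z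
    ((ContinuousAlternatingMap.apply ℝ F ℝ v).hasFDerivAt) hθ.hasFDerivAt

theorem fderiv_form_apply {F : Type*} [NormedAddCommGroup F] [NormedSpace ℝ F]
    {θ : E → F [⋀^Fin k]→L[ℝ] ℝ} {z : E} (hθ : DifferentiableAt ℝ θ z) (v : Fin k → F) (w : E) :
    fderiv ℝ (fun y => θ y v) z w = fderiv ℝ θ z w v := by
  rw [(hasFDerivAt_form_apply hθ v).fderiv]
  rfl

variable [FiniteDimensional ℝ E]

/-- In finite dimension a form is a finite combination of fixed decomposable forms, whose
coefficients are its values on basis vectors. -/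
theorem differentiableAt_form {θ : E → E [⋀^Fin k]→L[ℝ] ℝ} {z : E}
    (h : ∀ v, DifferentiableAt ℝ (fun y => θ y v) z) : DifferentiableAt ℝ θ z := by
  rw [funext fun y => eq_sum_wedge (θ y)]
  refine DifferentiableAt.const_smul (DifferentiableAt.fun_sum fun i _ => ?_) (_ : ℝ)
  exact (h fun l => Module.finBasis ℝ E (i l)).smul_const (F := E [⋀^Fin k]→L[ℝ] ℝ) _

theorem differentiableAt_wedge {ξ : E → Fin k → E →L[ℝ] ℝ} {z : E}
    (h : ∀ i, DifferentiableAt ℝ (fun y => ξ y i) z) :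
    DifferentiableAt ℝ (fun y => wedge (ξ y)) z := by
  refine differentiableAt_form fun v => ?_
  simp only [wedge_apply]
  refine DifferentiableAt.fun_sum fun σ _ => ?_
  have h' : DifferentiableAt ℝ (fun y => ∏ l, ξ y l (v (σ l))) z :=
    (HasFDerivAt.finsetProd fun l _ =>
      ((h l).clm_apply (differentiableAt_const _)).hasFDerivAt).differentiableAt
  rcases Int.units_eq_one_or (Equiv.Perm.sign σ) with hs | hs
  · simpa [hs] using h'
  · simpa [hs] using h'.neg

theorem hasFDerivAt_sharpAt {P : E → (E →L[ℝ] ℝ) [⋀^Fin (k + 2)]→L[ℝ] ℝ}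
    {α : E → E [⋀^Fin (k + 1)]→L[ℝ] ℝ} {z : E} (hP : DifferentiableAt ℝ P z)
    (hα : DifferentiableAt ℝ α z) :
    DifferentiableAt ℝ (fun y => sharpAt (P y) (α y)) z ∧ ∀ w,
      fderiv ℝ (fun y => sharpAt (P y) (α y)) z w =
        sharpAt (fderiv ℝ P z w) (α z) + sharpAt (P z) (fderiv ℝ α z w) := by
  have h := (HasFDerivAt.fun_sum (u := Finset.univ) fun (i : Fin (k + 1) →
      Fin (Module.finrank ℝ E)) _ => HasFDerivAt.fun_sum (u := Finset.univ)
      fun (j : Fin (Module.finrank ℝ E)) _ =>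
        (((hasFDerivAt_form_apply hα (fun l => Module.finBasis ℝ E (i l))).mul
          (hasFDerivAt_form_apply hP (Fin.snoc (α := fun _ => E →L[ℝ] ℝ)
            (fun l => dualVec (i l)) (dualVec j)))).smul_const
          (Module.finBasis ℝ E j))).const_smul ((k + 1).factorial : ℝ)⁻¹
  refine ⟨h.differentiableAt, fun w => ?_⟩
  refine (DFunLike.congr_fun h.fderiv w).trans ?_
  simp only [sharpAt, _root_.smul_apply, _root_.sum_apply,
    ContinuousLinearMap.smulRight_apply, _root_.add_apply, ContinuousLinearMap.comp_apply,
    ContinuousAlternatingMap.apply_apply, ← smul_add, ← Finset.sum_add_distrib, ← add_smul,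
    smul_eq_mul]
  congr 1
  refine Finset.sum_congr rfl fun i _ => Finset.sum_congr rfl fun j _ => ?_
  congr 1
  ring

/-- If the Lie derivative of `P` along `X` vanishes at `z`, then `L_X` commutes with `P^♯`. -/
theorem lieBracket_sharpAt {P : E → (E →L[ℝ] ℝ) [⋀^Fin (k + 2)]→L[ℝ] ℝ}
    {α : E → E [⋀^Fin (k + 1)]→L[ℝ] ℝ} {X : E → E} {z : E} (hP : DifferentiableAt ℝ P z)
    (hα : DifferentiableAt ℝ α z)
    (hX : ∀ ξ : Fin (k + 2) → E →L[ℝ] ℝ, fderiv ℝ P z (X z) ξ =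
      ∑ i, P z (Function.update ξ i (ξ i ∘L fderiv ℝ X z))) :
    VectorField.lieBracket ℝ X (fun y => sharpAt (P y) (α y)) z =
      sharpAt (P z) (lieDerivModel X α z) := by
  -- By `hX`, differentiating `P` along `X` produces `DX(P^♯ α)`, which cancels the second half of
  -- the bracket, and `P^♯` of the action of `DX` on `α`, which completes `L_X α`.
  rw [VectorField.lieBracket, (hasFDerivAt_sharpAt hP hα).2, sharpAt_derivation hX, lieDerivModel,
    sharpAt_add_right]
  abel

end Calculus

/-! ### Passage between the manifold and its charts. -/

section Charts

variable {E : Type*} [NormedAddCommGroup E] [NormedSpace ℝ E]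
variable {M : Type*} [TopologicalSpace M] [ChartedSpace E M]
variable {k : ℕ}

theorem vectorInChart_add (x : M) (X Y : VField E M) :
    vectorInChart x (X + Y) = vectorInChart x X + vectorInChart x Y :=
  VectorField.mpullback_add

theorem vectorInChart_smul (x : M) (c : ℝ) (X : VField E M) :
    vectorInChart x (c • X) = c • vectorInChart x X :=
  VectorField.mpullback_const_smul

theorem vectorInChart_zero (x : M) : vectorInChart x (0 : VField E M) = 0 :=
  VectorField.mpullback_zero

theorem formInChart_add (x : M) (θ η : Form E M k) :
    formInChart x (θ + η) = formInChart x θ + formInChart x η :=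
  rfl

theorem IsSmoothForm.differentiableAt {θ : Form E M k} (hθ : IsSmoothForm θ) (x : M) :
    DifferentiableAt ℝ (formInChart x θ) (extChartAt 𝓘(ℝ, E) x x) :=
  ((hθ x).contDiffAt (extChartAt_target_mem_nhds x)).differentiableAt (by simp)

theorem IsSmoothMultiVField.differentiableAt {P : MultiVField E M k} (hP : IsSmoothMultiVField P)
    (x : M) : DifferentiableAt ℝ (multivectorInChart x P) (extChartAt 𝓘(ℝ, E) x x) :=
  ((hP x).contDiffAt (extChartAt_target_mem_nhds x)).differentiableAt (by simp)

/-- A vector field is differentiable at `x` if it is so in the chart at `x`. -/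
def VDiffAt (X : VField E M) (x : M) : Prop :=
  DifferentiableAt ℝ (vectorInChart x X) (extChartAt 𝓘(ℝ, E) x x)

/-- A form is differentiable at `x` if it is so in the chart at `x`. -/
def FDiffAt (θ : Form E M k) (x : M) : Prop :=
  DifferentiableAt ℝ (formInChart x θ) (extChartAt 𝓘(ℝ, E) x x)

theorem VDiffAt.add {X Y : VField E M} {x : M} (hX : VDiffAt X x) (hY : VDiffAt Y x) :
    VDiffAt (X + Y) x := by
  rw [VDiffAt, vectorInChart_add]
  exact DifferentiableAt.add hX hY

variable [IsManifold 𝓘(ℝ, E) ∞ M]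

theorem chartD_comp_chartSymmD {x : M} {z : E} (hz : z ∈ (extChartAt 𝓘(ℝ, E) x).target) :
    chartD x ((extChartAt 𝓘(ℝ, E) x).symm z) ∘L chartSymmD x z = ContinuousLinearMap.id ℝ E := by
  have h := mfderiv_extChartAt_comp_mfderivWithin_extChartAt_symm (I := 𝓘(ℝ, E)) hz
  rw [modelWithCornersSelf_coe, Set.range_id, mfderivWithin_univ] at h
  exact h

theorem chartSymmD_comp_chartD {x : M} {z : E} (hz : z ∈ (extChartAt 𝓘(ℝ, E) x).target) :
    chartSymmD x z ∘L chartD x ((extChartAt 𝓘(ℝ, E) x).symm z) = ContinuousLinearMap.id ℝ E := by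
  have h := mfderivWithin_extChartAt_symm_comp_mfderiv_extChartAt (I := 𝓘(ℝ, E)) hz
  rw [modelWithCornersSelf_coe, Set.range_id, mfderivWithin_univ] at h
  exact h

/-- `T_x M` is identified with `E` through the chart at `x` itself. Hence at the centre of a chart
every operation agrees with its model-space version, with no transport. -/
theorem chartD_self (x : M) : chartD x x = ContinuousLinearMap.id ℝ E :=
  mfderiv_extChartAt_self (I := 𝓘(ℝ, E))

theorem chartSymmD_self (x : M) :
    chartSymmD x (extChartAt 𝓘(ℝ, E) x x) = ContinuousLinearMap.id ℝ E := by
  have h := chartD_comp_chartSymmD (mem_extChartAt_target (I := 𝓘(ℝ, E)) x)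
  rwa [extChartAt_to_inv, chartD_self] at h

theorem vectorInChart_of_mem (X : VField E M) {x : M} {z : E}
    (hz : z ∈ (extChartAt 𝓘(ℝ, E) x).target) :
    vectorInChart x X z =
      chartD (E := E) x ((extChartAt 𝓘(ℝ, E) x).symm z) (X ((extChartAt 𝓘(ℝ, E) x).symm z)) := by
  have h : (chartSymmD x z).inverse = chartD x ((extChartAt 𝓘(ℝ, E) x).symm z) :=
    ContinuousLinearMap.inverse_eq (chartSymmD_comp_chartD hz) (chartD_comp_chartSymmD hz)
  exact DFunLike.congr_fun h _

theorem chartSymmD_vectorInChart (X : VField E M) {x : M} {z : E}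
    (hz : z ∈ (extChartAt 𝓘(ℝ, E) x).target) :
    chartSymmD x z (vectorInChart x X z) = X ((extChartAt 𝓘(ℝ, E) x).symm z) := by
  rw [vectorInChart_of_mem X hz]
  exact DFunLike.congr_fun (chartSymmD_comp_chartD hz) _

theorem vectorInChart_self (X : VField E M) (x : M) :
    vectorInChart x X (extChartAt 𝓘(ℝ, E) x x) = X x := by
  rw [vectorInChart_of_mem X (mem_extChartAt_target x), extChartAt_to_inv, chartD_self]
  rfl

theorem formInChart_self (θ : Form E M k) (x : M) :
    formInChart x θ (extChartAt 𝓘(ℝ, E) x x) = θ x := by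
  rw [formInChart, chartSymmD_self, extChartAt_to_inv]
  rfl

theorem multivectorInChart_self (P : MultiVField E M k) (x : M) :
    multivectorInChart x P (extChartAt 𝓘(ℝ, E) x x) = P x := by
  rw [multivectorInChart, extChartAt_to_inv, chartD_self]
  rfl

/-- Equality near the centre, not just at it, is needed because both sides will be differentiated.
-/
theorem formInChart_interiorProd (x : M) (X : VField E M) (θ : Form E M (k + 1)) :
    formInChart x (interiorProd X θ) =ᶠ[𝓝 (extChartAt 𝓘(ℝ, E) x x)]
      fun z => (formInChart x θ z).curryLeft (vectorInChart x X z) := by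
  filter_upwards [extChartAt_target_mem_nhds (I := 𝓘(ℝ, E)) x] with z hz
  ext v
  have h := chartSymmD_vectorInChart X hz
  change θ _ (Matrix.vecCons (X ((extChartAt 𝓘(ℝ, E) x).symm z)) _) = θ _ _
  rw [← h]
  congr 1
  funext j
  refine Fin.cases ?_ (fun j => ?_) j <;> rfl

theorem extD_apply (θ : Form E M k) (x : M) :
    extD θ x = extDeriv (formInChart x θ) (extChartAt 𝓘(ℝ, E) x x) := by
  rw [extD, chartD_self]
  rfl

theorem lieD_apply (X : VField E M) (θ : Form E M k) (x : M) :
    lieD X θ x =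
      lieDerivModel (vectorInChart x X) (formInChart x θ) (extChartAt 𝓘(ℝ, E) x x) := by
  rw [lieD, chartD_self]
  rfl

theorem lieBr_apply (X Y : VField E M) (x : M) :
    lieBr X Y x = VectorField.lieBracket ℝ (vectorInChart x X) (vectorInChart x Y)
      (extChartAt 𝓘(ℝ, E) x x) := by
  have h := VectorField.mlieBracketWithin_apply (I := 𝓘(ℝ, E)) (V := X) (W := Y) (s := Set.univ)
    (x₀ := x)
  rw [VectorField.mlieBracketWithin_univ] at h
  refine h.trans ?_
  have h' : (chartD x x).inverse = ContinuousLinearMap.id ℝ E := by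
    rw [chartD_self, ContinuousLinearMap.inverse_id]
  refine (DFunLike.congr_fun h' _).trans ?_
  have hX := VectorField.mpullbackWithin_univ (I := 𝓘(ℝ, E)) (I' := 𝓘(ℝ, E))
    (f := (extChartAt 𝓘(ℝ, E) x).symm) (V := X)
  have hY := VectorField.mpullbackWithin_univ (I := 𝓘(ℝ, E)) (I' := 𝓘(ℝ, E))
    (f := (extChartAt 𝓘(ℝ, E) x).symm) (V := Y)
  rw [modelWithCornersSelf_coe, Set.range_id, Set.preimage_univ, Set.univ_inter]
  exact (congrFun (VectorField.lieBracketWithin_univ (E := E)) _).trans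
    (congrArg₂ (fun V W : E → E => VectorField.lieBracket ℝ V W _) hX hY)

theorem FDiffAt.interiorProd {X : VField E M} {θ : Form E M (k + 1)} {x : M} (hX : VDiffAt X x)
    (hθ : FDiffAt θ x) : FDiffAt (interiorProd X θ) x :=
  ((hasFDerivAt_contract hX hθ).differentiableAt).congr_of_eventuallyEq
    (formInChart_interiorProd x X θ)

theorem lieD_eq_cartan {X : VField E M} {θ : Form E M (k + 1)} {x : M} (hX : VDiffAt X x)
    (hθ : FDiffAt θ x) :
    lieD X θ x = interiorProd X (extD θ) x + extD (interiorProd X θ) x := by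
  rw [lieD_apply, lieDerivModel_eq_cartan hX hθ, extD_apply,
    (formInChart_interiorProd x X θ).extDeriv_eq, vectorInChart_self, interiorProd, extD_apply]

theorem lieD_interiorProd {X Y : VField E M} {θ : Form E M (k + 1)} {x : M} (hY : VDiffAt Y x)
    (hθ : FDiffAt θ x) :
    lieD X (interiorProd Y θ) x =
      interiorProd (lieBr X Y) θ x + interiorProd Y (lieD X θ) x := by
  rw [lieD_apply, lieDerivModel_congr (formInChart_interiorProd x Y θ),
    lieDerivModel_contract hY hθ, interiorProd, interiorProd, lieD_apply, lieBr_apply,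
    formInChart_self, vectorInChart_self]

theorem lieD_add_left {X Y : VField E M} {θ : Form E M k} {x : M} (hX : VDiffAt X x)
    (hY : VDiffAt Y x) : lieD (X + Y) θ x = lieD X θ x + lieD Y θ x := by
  simp only [lieD_apply, vectorInChart_add]
  exact lieDerivModel_add_left hX hY

theorem lieD_smul_left (c : ℝ) (X : VField E M) (θ : Form E M k) (x : M) :
    lieD (c • X) θ x = c • lieD X θ x := by
  simp only [lieD_apply, vectorInChart_smul]
  exact lieDerivModel_smul_left c

theorem lieD_add_right {X : VField E M} {θ η : Form E M k} {x : M} (hθ : FDiffAt θ x)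
    (hη : FDiffAt η x) : lieD X (θ + η) x = lieD X θ x + lieD X η x := by
  simp only [lieD_apply, formInChart_add]
  exact lieDerivModel_add_right hθ hη

theorem lieBr_add_left {X Y Z : VField E M} {x : M} (hX : VDiffAt X x) (hY : VDiffAt Y x) :
    lieBr (X + Y) Z x = lieBr X Z x + lieBr Y Z x := by
  rw [lieBr_apply, lieBr_apply, lieBr_apply, vectorInChart_add]
  exact VectorField.lieBracket_add_left (E := E) hX hY

theorem lieBr_smul_left {X Z : VField E M} {x : M} (c : ℝ) (hX : VDiffAt X x) :
    lieBr (c • X) Z x = c • lieBr X Z x := by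
  rw [lieBr_apply, lieBr_apply, vectorInChart_smul]
  exact VectorField.lieBracket_const_smul_left (E := E) hX

/-- The differential of a smooth function, in a chart. -/
theorem hasFDerivAt_inChart (f : C^∞⟮𝓘(ℝ, E), M; ℝ⟯) {x : M} {z : E}
    (hz : z ∈ (extChartAt 𝓘(ℝ, E) x).target) :
    HasFDerivAt (fun y => f ((extChartAt 𝓘(ℝ, E) x).symm y))
      (dFun f ((extChartAt 𝓘(ℝ, E) x).symm z) ∘L chartSymmD x z) z := by
  have h₁ : MDifferentiableAt 𝓘(ℝ, E) 𝓘(ℝ, ℝ) f ((extChartAt 𝓘(ℝ, E) x).symm z) :=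
    f.contMDiff.mdifferentiableAt (by simp)
  have h₂ : MDifferentiableAt 𝓘(ℝ, E) 𝓘(ℝ, E) (extChartAt 𝓘(ℝ, E) x).symm z := by
    have h := mdifferentiableWithinAt_extChartAt_symm (I := 𝓘(ℝ, E)) hz
    rwa [modelWithCornersSelf_coe, Set.range_id, mdifferentiableWithinAt_univ] at h
  exact (h₁.hasMFDerivAt.comp z h₂.hasMFDerivAt).hasFDerivAt

theorem contDiffOn_inChart (f : C^∞⟮𝓘(ℝ, E), M; ℝ⟯) (x : M) :
    ContDiffOn ℝ ∞ (fun y => f ((extChartAt 𝓘(ℝ, E) x).symm y))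
      (extChartAt 𝓘(ℝ, E) x).target :=
  (f.contMDiff.comp_contMDiffOn (contMDiffOn_extChartAt_symm x)).contDiffOn

theorem differentiableAt_fderiv_inChart (f : C^∞⟮𝓘(ℝ, E), M; ℝ⟯) (x : M) :
    DifferentiableAt ℝ (fderiv ℝ fun y => f ((extChartAt 𝓘(ℝ, E) x).symm y))
      (extChartAt 𝓘(ℝ, E) x x) :=
  (((contDiffOn_inChart f x).contDiffAt (extChartAt_target_mem_nhds x)).fderiv_right
    (m := 1) (WithTop.coe_le_coe.mpr le_top : ((1 + 1 : ℕ∞) : WithTop ℕ∞) ≤ _)).differentiableAt (by simp)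

/-- Every covector is, near `x`, the coordinate expression of a globally defined smooth
function. -/
theorem exists_linear_inChart [FiniteDimensional ℝ E] [T2Space M] (x : M) (ξ : E →L[ℝ] ℝ) :
    ∃ g : C^∞⟮𝓘(ℝ, E), M; ℝ⟯, ∀ᶠ z in 𝓝 (extChartAt 𝓘(ℝ, E) x x),
      g ((extChartAt 𝓘(ℝ, E) x).symm z) = ξ z := by
  let ψ : SmoothBumpFunction 𝓘(ℝ, E) x := Classical.arbitrary _
  -- The coordinate function is cut off by a bump function; `M` being Hausdorff makes the extension
  -- by zero smooth.
  have hg : ContMDiff 𝓘(ℝ, E) 𝓘(ℝ, ℝ) ∞ fun y => ψ y • ξ (extChartAt 𝓘(ℝ, E) x y) :=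
    ψ.contMDiff_smul (ξ.contDiff.contMDiff.comp_contMDiffOn contMDiffOn_extChartAt)
  refine ⟨⟨_, hg⟩, ?_⟩
  have hc := (continuousAt_extChartAt_symm (I := 𝓘(ℝ, E)) x).tendsto
  rw [extChartAt_to_inv] at hc
  filter_upwards [hc.eventually ψ.eventuallyEq_one, extChartAt_target_mem_nhds (I := 𝓘(ℝ, E)) x]
    with z h₁ hz
  change ψ _ • ξ (extChartAt 𝓘(ℝ, E) x _) = ξ z
  rw [h₁, (extChartAt 𝓘(ℝ, E) x).right_inv hz]
  simp

theorem multivectorInChart_apply_fderiv (P : MultiVField E M k)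
    (f : Fin k → C^∞⟮𝓘(ℝ, E), M; ℝ⟯) {x : M} {z : E} (hz : z ∈ (extChartAt 𝓘(ℝ, E) x).target) :
    multivectorInChart x P z
        (fun i => fderiv ℝ (fun y => f i ((extChartAt 𝓘(ℝ, E) x).symm y)) z) =
      P ((extChartAt 𝓘(ℝ, E) x).symm z) (fun i => dFun (f i) ((extChartAt 𝓘(ℝ, E) x).symm z)) := by
  change P _ _ = P _ _
  congr 1
  funext i
  change fderiv ℝ _ z ∘L chartD x ((extChartAt 𝓘(ℝ, E) x).symm z) = _
  rw [(hasFDerivAt_inChart (f i) hz).fderiv, ContinuousLinearMap.comp_assoc,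
    chartSymmD_comp_chartD hz, ContinuousLinearMap.comp_id]

theorem formInChart_dWedge (f : Fin k → C^∞⟮𝓘(ℝ, E), M; ℝ⟯) {x : M} {z : E}
    (hz : z ∈ (extChartAt 𝓘(ℝ, E) x).target) :
    formInChart x (dWedge f) z =
      wedge (fun i => fderiv ℝ (fun y => f i ((extChartAt 𝓘(ℝ, E) x).symm y)) z) := by
  rw [formInChart, dWedge, wedge_comp]
  congr 1
  funext i
  exact (hasFDerivAt_inChart (f i) hz).fderiv.symm

variable [FiniteDimensional ℝ E]

/-- This is naturality of `P^♯` under the chart differential, which is inverse to the map pulling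
`α` back to the chart. -/
theorem vectorInChart_sharp (P : MultiVField E M (k + 2)) (α : Form E M (k + 1)) {x : M} {z : E}
    (hz : z ∈ (extChartAt 𝓘(ℝ, E) x).target) :
    vectorInChart x (sharp P α) z = sharpAt (multivectorInChart x P z) (formInChart x α z) := by
  have h : (formInChart x α z).compContinuousLinearMap
      (chartD x ((extChartAt 𝓘(ℝ, E) x).symm z)) = α ((extChartAt 𝓘(ℝ, E) x).symm z) := by
    ext v
    change α _ (fun i => (chartSymmD x z ∘L chartD x _) (v i)) = _
    rw [chartSymmD_comp_chartD hz]
    rfl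
  rw [vectorInChart_of_mem _ hz, multivectorInChart, sharpAt_comp, h]
  rfl

theorem vectorInChart_sharp_eventuallyEq (P : MultiVField E M (k + 2)) (α : Form E M (k + 1))
    (x : M) :
    vectorInChart x (sharp P α) =ᶠ[𝓝 (extChartAt 𝓘(ℝ, E) x x)]
      fun z => sharpAt (multivectorInChart x P z) (formInChart x α z) := by
  filter_upwards [extChartAt_target_mem_nhds (I := 𝓘(ℝ, E)) x] with z hz
  exact vectorInChart_sharp P α hz

theorem VDiffAt.sharp {P : MultiVField E M (k + 2)} (hP : IsSmoothMultiVField P)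
    {α : Form E M (k + 1)} {x : M} (hα : FDiffAt α x) : VDiffAt (sharp P α) x :=
  (hasFDerivAt_sharpAt (hP.differentiableAt x) hα).1.congr_of_eventuallyEq
    (vectorInChart_sharp_eventuallyEq P α x)

theorem FDiffAt.dWedge (f : Fin k → C^∞⟮𝓘(ℝ, E), M; ℝ⟯) (x : M) : FDiffAt (dWedge f) x := by
  have h : formInChart x (NambuCourant.dWedge f) =ᶠ[𝓝 (extChartAt 𝓘(ℝ, E) x x)] fun z =>
      wedge (fun i => fderiv ℝ (fun y => f i ((extChartAt 𝓘(ℝ, E) x).symm y)) z) := by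
    filter_upwards [extChartAt_target_mem_nhds (I := 𝓘(ℝ, E)) x] with z hz
    exact formInChart_dWedge f hz
  exact (differentiableAt_wedge fun i =>
    differentiableAt_fderiv_inChart (f i) x).congr_of_eventuallyEq h

end Charts

/-! ### Invariance of `π` under Hamiltonian fields, and the reduced bracket. -/

section Hamiltonian

variable {E : Type*} [NormedAddCommGroup E] [NormedSpace ℝ E] [FiniteDimensional ℝ E]
variable {M : Type*} [TopologicalSpace M] [ChartedSpace E M] [IsManifold 𝓘(ℝ, E) ∞ M]
variable {k : ℕ} {π : MultiVField E M (k + 2)}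

/-- The bracket with `f₁, …, f_{n-1}` is the derivative along the Hamiltonian vector field. -/
theorem bracket_snoc_inChart {N : NambuPoissonBracket E M k}
    (hN : ∀ (f : Fin (k + 2) → C^∞⟮𝓘(ℝ, E), M; ℝ⟯) (x : M),
      N.bracket f x = π x (fun i => dFun (f i) x))
    (f : Fin (k + 1) → C^∞⟮𝓘(ℝ, E), M; ℝ⟯) (h : C^∞⟮𝓘(ℝ, E), M; ℝ⟯) {x : M} {z : E}
    (hz : z ∈ (extChartAt 𝓘(ℝ, E) x).target) :
    N.bracket (Fin.snoc (α := fun _ => C^∞⟮𝓘(ℝ, E), M; ℝ⟯) f h)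
        ((extChartAt 𝓘(ℝ, E) x).symm z) =
      fderiv ℝ (fun y => h ((extChartAt 𝓘(ℝ, E) x).symm y)) z
        (vectorInChart x (sharp π (dWedge f)) z) := by
  rw [hN, ← multivectorInChart_apply_fderiv π _ hz, vectorInChart_sharp _ _ hz,
    formInChart_dWedge f hz, sharpAt_wedge]
  congr 1
  funext i
  refine Fin.lastCases ?_ (fun i => ?_) i <;> simp

/-- The Lie derivative of `π` along a Hamiltonian vector field vanishes. -/
theorem fderiv_multivectorInChart_hamiltonian [T2Space M] (hπ : IsSmoothMultiVField π)
    {N : NambuPoissonBracket E M k}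
    (hN : ∀ (f : Fin (k + 2) → C^∞⟮𝓘(ℝ, E), M; ℝ⟯) (x : M),
      N.bracket f x = π x (fun i => dFun (f i) x))
    (f : Fin (k + 1) → C^∞⟮𝓘(ℝ, E), M; ℝ⟯) (x : M) (ξ : Fin (k + 2) → E →L[ℝ] ℝ) :
    fderiv ℝ (multivectorInChart x π) (extChartAt 𝓘(ℝ, E) x x)
        (vectorInChart x (sharp π (dWedge f)) (extChartAt 𝓘(ℝ, E) x x)) ξ =
      ∑ i, multivectorInChart x π (extChartAt 𝓘(ℝ, E) x x) (Function.update ξ i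
        (ξ i ∘L fderiv ℝ (vectorInChart x (sharp π (dWedge f))) (extChartAt 𝓘(ℝ, E) x x))) := by
  set z₀ := extChartAt 𝓘(ℝ, E) x x with hz₀
  set X := vectorInChart x (sharp π (dWedge f)) with hX
  have hXd : DifferentiableAt ℝ X z₀ := VDiffAt.sharp hπ (FDiffAt.dWedge f x)
  have hmem : z₀ ∈ (extChartAt 𝓘(ℝ, E) x).target := mem_extChartAt_target x
  have hnhds := extChartAt_target_mem_nhds (I := 𝓘(ℝ, E)) x
  -- With `g i` linear near the centre, `dgᵢ = ξ i` is constant there, so the derivative of `{g₁, …,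
  -- g_n} = π(ξ)` sees only the variation of `π`.
  choose g hg using fun i => exists_linear_inChart x (ξ i)
  have hdg : ∀ i, ∀ᶠ z in 𝓝 z₀,
      fderiv ℝ (fun y => g i ((extChartAt 𝓘(ℝ, E) x).symm y)) z = ξ i := by
    intro i
    filter_upwards [(hg i).eventually_nhds] with z hz
    have h : (fun y => g i ((extChartAt 𝓘(ℝ, E) x).symm y)) =ᶠ[𝓝 z] ξ i := hz
    rw [h.fderiv_eq, ContinuousLinearMap.fderiv]
  have hbr : (fun z => N.bracket g ((extChartAt 𝓘(ℝ, E) x).symm z)) =ᶠ[𝓝 z₀]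
      fun z => multivectorInChart x π z ξ := by
    filter_upwards [Filter.eventually_all.mpr hdg, hnhds] with z hz hzt
    rw [hN, ← multivectorInChart_apply_fderiv π _ hzt]
    simp only [hz]
  -- Near the centre `{f₁, …, f_{n-1}, gᵢ} = ξ i (X)`, and `ξ i` is constant.
  have hbr' : ∀ i, fderiv ℝ (fun z => N.bracket
      (Fin.snoc (α := fun _ => C^∞⟮𝓘(ℝ, E), M; ℝ⟯) f (g i)) ((extChartAt 𝓘(ℝ, E) x).symm z)) z₀ =
      ξ i ∘L fderiv ℝ X z₀ := by
    intro i
    have h : (fun z => N.bracket (Fin.snoc (α := fun _ => C^∞⟮𝓘(ℝ, E), M; ℝ⟯) f (g i))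
        ((extChartAt 𝓘(ℝ, E) x).symm z)) =ᶠ[𝓝 z₀] fun z => ξ i (X z) := by
      filter_upwards [hdg i, hnhds] with z hz hzt
      rw [bracket_snoc_inChart hN f (g i) hzt, hz]
    rw [h.fderiv_eq]
    exact ((ξ i).hasFDerivAt.comp z₀ hXd.hasFDerivAt).fderiv
  have hF := congrArg (fun h : C^∞⟮𝓘(ℝ, E), M; ℝ⟯ => h ((extChartAt 𝓘(ℝ, E) x).symm z₀))
    (N.fundamental f g)
  have hsum : ∀ (s : Fin (k + 2) → C^∞⟮𝓘(ℝ, E), M; ℝ⟯) (y : M), (∑ i, s i) y = ∑ i, s i y :=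
    fun s y => by
      simpa using congrFun (map_sum (ContMDiffMap.coeFnAddMonoidHom (I := 𝓘(ℝ, E))
        (I' := 𝓘(ℝ, ℝ)) (N := M) (G := ℝ) (n := ∞)) s Finset.univ) y
  simp only [hsum] at hF
  rw [bracket_snoc_inChart hN f _ hmem, hbr.fderiv_eq,
    fderiv_form_apply (hπ.differentiableAt x)] at hF
  refine hF.trans (Finset.sum_congr rfl fun i _ => ?_)
  rw [hN, ← multivectorInChart_apply_fderiv π _ hmem]
  congr 1
  funext j
  by_cases h : j = i
  · subst h
    simp only [Function.update_self]
    exact hbr' j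
  · simp only [Function.update_of_ne h]
    exact (hdg j).self_of_nhds

/-- Hamiltonian vector fields are differentiable, and their Lie derivatives commute with
`π^♯`. -/
theorem hamiltonianFields_lieBr_sharp [T2Space M] (hπ : IsNambuPoisson π) {X : VField E M}
    (hX : X ∈ hamiltonianFields π) {α : Form E M (k + 1)} {x : M} (hα : FDiffAt α x) :
    VDiffAt X x ∧ lieBr X (sharp π α) x = sharp π (lieD X α) x := by
  obtain ⟨hs, N, hN⟩ := hπ
  -- The two conclusions go together: additivity of the bracket and of `L_X α` in `X` requires
  -- differentiability of the summands.
  induction hX using Submodule.span_induction with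
  | mem X h =>
    obtain ⟨f, rfl⟩ := h
    refine ⟨VDiffAt.sharp hs (FDiffAt.dWedge f x), ?_⟩
    have h := lieBracket_sharpAt (hs.differentiableAt x) hα
      (fderiv_multivectorInChart_hamiltonian hs hN f x)
    rw [multivectorInChart_self, ← lieD_apply] at h
    exact (lieBr_apply _ _ x).trans (((Filter.EventuallyEq.rfl.lieBracket_vectorField
      (vectorInChart_sharp_eventuallyEq π α x)).self_of_nhds).trans h)
  | zero =>
    -- Homogeneity with scalar `0` gives `L_0 α = 0`.
    have h := lieD_smul_left 0 (0 : VField E M) α x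
    rw [zero_smul, zero_smul] at h
    refine ⟨?_, ?_⟩
    · rw [VDiffAt, vectorInChart_zero]
      exact differentiableAt_const (0 : E)
    · rw [lieBr, VectorField.mlieBracket_zero_left, sharp, h]
      exact ((sharpLin (π x)).map_zero).symm
  | add X Y _ _ hX hY =>
    refine ⟨hX.1.add hY.1, ?_⟩
    have h : sharp π (lieD (X + Y) α) x = sharp π (lieD X α) x + sharp π (lieD Y α) x :=
      (congrArg (sharpAt (π x)) (lieD_add_left hX.1 hY.1)).trans (sharpAt_add_right _ _ _)
    rw [lieBr_add_left hX.1 hY.1, hX.2, hY.2, h]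
  | smul c X _ hX =>
    refine ⟨?_, ?_⟩
    · rw [VDiffAt, vectorInChart_smul]
      exact DifferentiableAt.const_smul hX.1 c
    · have h : sharp π (lieD (c • X) α) x = c • sharp π (lieD X α) x :=
        (congrArg (sharpAt (π x)) (lieD_smul_left c X α x)).trans (sharpAt_smul_right _ _ _)
      rw [lieBr_smul_left c hX.1, hX.2, h]

/-- On Hamiltonian vector fields and closed forms, `⟦X + α, Y + β⟧_π` is
`[ρ(X + α), Y] + L_{ρ(X + α)} β`. -/
theorem courantBracket_of_closed [T2Space M] (hπ : IsNambuPoisson π) {e₁ e₂ : Sec E M (k + 1)}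
    (h₁ : e₁ ∈ (hamiltonianFields π : Set (VField E M)) ×ˢ closedForms E M (k + 1))
    (h₂ : e₂ ∈ (hamiltonianFields π : Set (VField E M)) ×ˢ closedForms E M (k + 1)) :
    courantBracket π e₁ e₂ = (lieBr (anchor π e₁) e₂.1, lieD (anchor π e₁) e₂.2) := by
  obtain ⟨hX₁, hα₁, hd₁⟩ := h₁
  obtain ⟨-, hα₂, -⟩ := h₂
  have hdX := fun x => (hamiltonianFields_lieBr_sharp hπ hX₁ (hα₁.differentiableAt x)).1
  have hdα : ∀ x, VDiffAt (sharp π e₁.2) x := fun x => VDiffAt.sharp hπ.1 (hα₁.differentiableAt x)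
  have hz : ∀ Y : VField E M, interiorProd Y (extD e₁.2) = 0 := fun Y => by
    rw [hd₁]; rfl
  have hs : sharp π (0 : Form E M (k + 1)) = 0 := funext fun x => (sharpLin (π x)).map_zero
  have hb : lieBr e₁.1 (sharp π e₂.2) = sharp π (lieD e₁.1 e₂.2) := funext fun x =>
    (hamiltonianFields_lieBr_sharp hπ hX₁ (hα₂.differentiableAt x)).2
  -- This makes the last two terms of `[α, β]_π` cancel.
  have hc : lieD (sharp π e₂.2) e₁.2 = extD (interiorProd (sharp π e₂.2) e₁.2) := funext fun x => by
    rw [lieD_eq_cartan (VDiffAt.sharp hπ.1 (hα₂.differentiableAt x)) (hα₁.differentiableAt x), hz]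
    exact zero_add _
  have ha : lieBr (anchor π e₁) e₂.1 = lieBr e₁.1 e₂.1 + lieBr (sharp π e₁.2) e₂.1 :=
    funext fun x => lieBr_add_left (hdX x) (hdα x)
  have hl : lieD (anchor π e₁) e₂.2 = lieD e₁.1 e₂.2 + lieD (sharp π e₁.2) e₂.2 :=
    funext fun x => lieD_add_left (hdX x) (hdα x)
  rw [courantBracket, formBracket, hz, hs, hb, hc, ha, hl]
  refine Prod.ext ?_ ?_ <;> dsimp only <;> abel

end Hamiltonian

end

end NambuCourant

/-! ### The invariance of the pairing. -/

open NambuCourant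
theorem corollary6p2
    {E : Type*} [NormedAddCommGroup E] [NormedSpace ℝ E] [FiniteDimensional ℝ E]
    {M : Type*} [TopologicalSpace M] [T2Space M] [ChartedSpace E M] [IsManifold 𝓘(ℝ, E) ∞ M]
    {k : ℕ} (π : MultiVField E M (k + 2)) (hπ : IsNambuPoisson π)
    (e₁ e₂ e₃ : Sec E M (k + 1))
    (h₁ : e₁ ∈ (hamiltonianFields π : Set (VField E M)) ×ˢ closedForms E M (k + 1))
    (h₂ : e₂ ∈ (hamiltonianFields π : Set (VField E M)) ×ˢ closedForms E M (k + 1))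
    (h₃ : e₃ ∈ (hamiltonianFields π : Set (VField E M)) ×ˢ closedForms E M (k + 1)) :
    lieD (anchor π e₁) (pairing e₂ e₃) =
      pairing (courantBracket π e₁ e₂) e₃ + pairing e₂ (courantBracket π e₁ e₃) := by
  rw [courantBracket_of_closed hπ h₁ h₂, courantBracket_of_closed hπ h₁ h₃]
  funext x
  have d₂ := h₂.2.1.differentiableAt x
  have d₃ := h₃.2.1.differentiableAt x
  have v₂ := (hamiltonianFields_lieBr_sharp hπ h₂.1 d₂).1
  have v₃ := (hamiltonianFields_lieBr_sharp hπ h₃.1 d₃).1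
  -- The Leibniz rule on `i_Y γ` and `i_W β`, for `e₂ = Y + β` and `e₃ = W + γ`, gives four terms;
  -- they are those of the two pairings on the right.
  rw [pairing, lieD_add_right (FDiffAt.interiorProd v₂ d₃) (FDiffAt.interiorProd v₃ d₂),
    lieD_interiorProd v₂ d₃, lieD_interiorProd v₃ d₂]
  simp only [pairing, Pi.add_apply]
  abel
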